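/- Let $S$ (states) and $A$ (actions) be finite nonempty sets, let $p(s,a,\cdot)$ be a probability distribution on $S$ for each $(s,a)\in S\times A$, and let $R:S\times A\times S\to\mathbb R$. A policy is an element of $$\Delta=\Big\{\pi\in\mathbb R^{S\times A}:\ \pi(s,a)\ge 0,\ \textstyle\sum_{a}\pi(s,a)=1\ \text{for all } s\in S\Big\},$$ and it generates the Markov chain $K_\pi(s,s')=\sum_a \pi(s,a)p(s,a,s')$. Assume that every policy is ergodic, i.e. for every $\pi\in\Delta$ some power $K_\pi^t$, $t>0$, has only positive entries. Then for every $\pi\in\Delta$ the chain has a unique stationary distribution $\lambda_\pi$, and the average reward $$\rho(\pi)=\lim_{T\to\infty}\frac1T\,\mathbb E_\pi\Big[\sum_{t=1}^T R(s(t),a(t),s(t+1))\Big]$$ exists and does not depend on the initial state $s(1)$. A policy is optimal if it maximizes $\rho$ over $\Delta$. Let $\nabla\rho$ be a gradient of $\rho$ on $\Delta$ with respect to the table entries, i.e. a vector field with $\rho(\pi')=\rho(\pi)+(\pi'-\pi)^T\nabla\rho(\pi)+o(\|\pi'-\pi\|)$ as $\pi'\to\pi$ in $\Delta$, for every $\pi\in\Delta$.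 (Such a field is determined up to vectors orthogonal to all differences of policies; any choice is allowed.) Let $\Pi^*=\{\pi\in\Delta:(\pi'-\pi)^T\nabla\rho(\pi)\le 0\text{ for all }\pi'\in\Delta\}$ be the set of stationary points of $\rho$, and assume that $$c=\sup_{\pi',\pi\in\Pi^*}\ \max_{s\in S}\ \frac{\lambda_{\pi'}(s)}{\lambda_\pi(s)}<\infty .$$ 1. (Gradient domination) If $\pi^*$ is an optimal policy and $\pi\in\Pi^*$, then $$\rho(\pi^*)-\rho(\pi)\le c\,\max_{\pi'\in\Delta}(\pi'-\pi)^T\nabla\rho(\pi).$$ 2. (Convergence) Suppose that $\nabla\rho$ is Lipschitz continuous on $\Delta$ in the Euclidean norm with a constant $L>0$, and let $\alpha\in(0,1/L]$. Let $\pi_0\in\Delta$ and $\pi_{k+1}=P_\Delta(\pi_k+\alpha\nabla\rho(\pi_k))$ for $k\ge 0$, where $P_\Delta$ is the Euclidean projection onto $\Delta$. Then the sequence $(\pi_k)$ has a limit point, and every limit point of $(\pi_k)$ is an optimal policy. -/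

import Mathlib

open Filter Topology

/-- A finite Markov decision process with states `S` and actions `A`: `p s a s'` is the probability
of moving from `s` to `s'` when `a` is played, and `R s a s'` is the reward of that transition. -/
structure FiniteMDP (S A : Type*) [Fintype S] where
  p : S → A → S → ℝ
  R : S → A → S → ℝ
  p_nonneg : ∀ s a s', 0 ≤ p s a s'
  p_sum : ∀ s a, ∑ s', p s a s' = 1

/-- The set of (stationary randomized) policies in direct tabular parametrization: tables `π (s, a)`
such that `π (s, ·)` is a probability vector on `A` for each state `s`. -/
def policySet (S A : Type*) [Fintype A] : Set (EuclideanSpace ℝ (S × A)) :=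
  {π | (∀ s a, 0 ≤ π (s, a)) ∧ ∀ s, ∑ a, π (s, a) = 1}

/-- `y` is the Euclidean projection of `x` onto `X`, that is, `y` minimizes `‖z - x‖ ^ 2` over
`z ∈ X` (for nonempty, closed and convex `X` there is exactly one such `y`). -/
def IsProjectionOn {E : Type*} [NormedAddCommGroup E] (X : Set E) (x y : E) : Prop :=
  y ∈ X ∧ IsMinOn (fun z => ‖z - x‖ ^ 2) X y

/-- `μ` is a stationary (invariant) distribution of the transition matrix `K`. -/
def IsStationaryDist {S : Type*} [Fintype S] (K : Matrix S S ℝ) (μ : S → ℝ) : Prop :=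
  (∀ s, 0 ≤ μ s) ∧ ∑ s, μ s = 1 ∧ ∀ s', ∑ s, μ s * K s s' = μ s'

namespace FiniteMDP

variable {S A : Type*} [Fintype S] [DecidableEq S] [Fintype A]

/-- The transition matrix `K_π(s, s') = ∑ₐ π(s, a) p(s, a, s')` of the chain generated by `π`. -/
def transitionMatrix (M : FiniteMDP S A) (π : EuclideanSpace ℝ (S × A)) : Matrix S S ℝ :=
  fun s s' => ∑ a, π (s, a) * M.p s a s'

/-- `π` is ergodic: the chain it generates is irreducible and aperiodic, that is, some power of its
transition matrix is entrywise positive. -/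
def IsErgodic (M : FiniteMDP S A) (π : EuclideanSpace ℝ (S × A)) : Prop :=
  ∃ t : ℕ, 0 < t ∧ ∀ s s', 0 < (M.transitionMatrix π ^ t) s s'

/-- The probability, under `π` and from the initial state `s₀`, of the finite history
`x 0, a 0, x 1, a 1, …, a (T - 1), x T`. -/
def historyProb (M : FiniteMDP S A) (π : EuclideanSpace ℝ (S × A)) (s₀ : S) {T : ℕ}
    (x : Fin (T + 1) → S) (a : Fin T → A) : ℝ :=
  (if x 0 = s₀ then 1 else 0) *
    ∏ t : Fin T, π (x t.castSucc, a t) * M.p (x t.castSucc) (a t) (x t.succ)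

/-- The expected total reward of the first `T` transitions under `π` from the initial state `s₀`. -/
def expectedTotalReward (M : FiniteMDP S A) (π : EuclideanSpace ℝ (S × A)) (s₀ : S) (T : ℕ) : ℝ :=
  ∑ x : Fin (T + 1) → S, ∑ a : Fin T → A,
    M.historyProb π s₀ x a * ∑ t : Fin T, M.R (x t.castSucc) (a t) (x t.succ)

/-- The average reward `ρ(π) = lim_T (1/T) E_π[∑_{t=1}^T R(s(t), a(t), s(t+1))]`, from an arbitrarily
fixed initial state. (That the limit exists and is the same from every initial state when all
policies are ergodic is asserted in the main theorem.) -/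
noncomputable def avgReward [Nonempty S] (M : FiniteMDP S A) (π : EuclideanSpace ℝ (S × A)) : ℝ :=
  limUnder atTop fun T : ℕ =>
    (1 / (T : ℝ)) * M.expectedTotalReward π (Classical.arbitrary S) T

/-- The stationary distribution `λ_π` of the chain generated by `π`. (That it exists and is unique
when all policies are ergodic is asserted in the main theorem.) -/
noncomputable def stationaryDist (M : FiniteMDP S A) (π : EuclideanSpace ℝ (S × A)) : S → ℝ :=
  Classical.epsilon fun μ => IsStationaryDist (M.transitionMatrix π) μ

/-- `π` is an optimal policy: it maximizes the average reward over all policies. -/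
def IsOptimal [Nonempty S] (M : FiniteMDP S A) (π : EuclideanSpace ℝ (S × A)) : Prop :=
  π ∈ policySet S A ∧ IsMaxOn M.avgReward (policySet S A) π

/-- `g` is a version of the gradient `∇ρ` on the set of policies: at every policy `π`,
`ρ(π') = ρ(π) + ⟪g π, π' - π⟫ + o(‖π' - π‖)` as `π' → π` within the set of policies. The policies
span a proper affine subspace, so this fixes `g π` up to a vector orthogonal to all differences of
policies; the restriction to policies of the gradient of any differentiable extension of `ρ` to a
neighbourhood is such a `g`. -/
def IsGradientField [Nonempty S] (M : FiniteMDP S A)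
    (g : EuclideanSpace ℝ (S × A) → EuclideanSpace ℝ (S × A)) : Prop :=
  ∀ π ∈ policySet S A, HasGradientWithinAt M.avgReward (g π) (policySet S A) π

end FiniteMDP

/-- The policies that are stationary points for maximization when the gradient field is `g`:
`⟪π' - π, g π⟫ ≤ 0` for every policy `π'`. -/
def stationaryPolicies {S A : Type*} [Fintype S] [Fintype A]
    (g : EuclideanSpace ℝ (S × A) → EuclideanSpace ℝ (S × A)) : Set (EuclideanSpace ℝ (S × A)) :=
  {π | π ∈ policySet S A ∧ ∀ π' ∈ policySet S A, inner ℝ (π' - π) (g π) ≤ 0}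

/-- The constant `c`, the supremum of `λ_π'(s) / λ_π(s)` over stationary points `π', π` and states
`s`, as an extended nonnegative real. -/
noncomputable def FiniteMDP.ratioConst {S A : Type*} [Fintype S] [DecidableEq S] [Fintype A]
    (M : FiniteMDP S A) (g : EuclideanSpace ℝ (S × A) → EuclideanSpace ℝ (S × A)) : ENNReal :=
  ⨆ π' ∈ stationaryPolicies g, ⨆ π ∈ stationaryPolicies g, ⨆ s : S,
    ENNReal.ofReal (M.stationaryDist π' s) / ENNReal.ofReal (M.stationaryDist π s)

/-- `π 0, π 1, …` is generated by projected gradient ascent with gradient field `g` and constant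
step size `α`, started at a policy. -/
def IsProjectedPolicyGradient {S A : Type*} [Fintype S] [Fintype A]
    (g : EuclideanSpace ℝ (S × A) → EuclideanSpace ℝ (S × A)) (α : ℝ)
    (π : ℕ → EuclideanSpace ℝ (S × A)) : Prop :=
  π 0 ∈ policySet S A ∧ ∀ k, IsProjectionOn (policySet S A) (π k + α • g (π k)) (π (k + 1))

/-! ### Finite stochastic matrices: Poisson equation and stationary distributions. -/

section StochasticMatrix

variable {S : Type*} [Fintype S] {K : Matrix S S ℝ}

open Matrix

/-! Everything rests on one fact: a stationary point of `ρ` is already optimal. At such a point the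
maximum in the gradient domination bound is `0` and the left side is at most `0`; for convergence,
it remains to see that limit points of projected ascent are stationary.

Let `h` solve the Poisson equation of `π`. By `performance_difference`, `ρ(π') - ρ(π)` is the
average under `λ_π'` of the statewise advantages of `π'` over `π`. If some advantage `D` at a state
`o` were positive, move from `π` towards the policy that copies `π'` at `o` only. A step `r` gains
exactly `r * D` times the current stationary mass of `o`. For `r ≤ 1/2` that mass is at least a
fixed `δ > 0` (`exists_pos_le_of_half_le`), so the directional derivative is at least `δ * D > 0`,
against stationarity. Hence all advantages are nonpositive and `π` is optimal. No derivative of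
`λ_π` is computed.

The Markov chain theory comes from the bijectivity of `poissonMap`. Stationarity of limit points
follows from the descent lemma and the variational inequality of the projection. -/

lemma mulVec_le_of_le (h0 : ∀ s s', 0 ≤ K s s') (h1 : ∀ s, ∑ s', K s s' = 1) {f : S → ℝ} {b : ℝ}
    (hf : ∀ s, f s ≤ b) (s : S) : (K *ᵥ f) s ≤ b := by
  calc (K *ᵥ f) s = ∑ s', K s s' * f s' := rfl
    _ ≤ ∑ s', K s s' * b := Finset.sum_le_sum fun s' _ => mul_le_mul_of_nonneg_left (hf s') (h0 s s')
    _ = b := by rw [← Finset.sum_mul, h1, one_mul]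

lemma le_mulVec_of_le (h0 : ∀ s s', 0 ≤ K s s') (h1 : ∀ s, ∑ s', K s s' = 1) {f : S → ℝ} {b : ℝ}
    (hf : ∀ s, b ≤ f s) (s : S) : b ≤ (K *ᵥ f) s := by
  calc b = ∑ s', K s s' * b := by rw [← Finset.sum_mul, h1, one_mul]
    _ ≤ ∑ s', K s s' * f s' := Finset.sum_le_sum fun s' _ => mul_le_mul_of_nonneg_left (hf s') (h0 s s')

lemma mulVec_const_of_row_sum (h1 : ∀ s, ∑ s', K s s' = 1) (b : ℝ) :
    (K *ᵥ fun _ => b) = fun _ => b := by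
  funext s
  change ∑ s', K s s' * b = b
  rw [← Finset.sum_mul, h1, one_mul]

/-- The constant in the Poisson equation is at least every lower bound of the right-hand side. -/
lemma le_of_poisson [Nonempty S] (h0 : ∀ s s', 0 ≤ K s s') (h1 : ∀ s, ∑ s', K s s' = 1)
    {f h : S → ℝ} {b c : ℝ} (hb : ∀ s, b ≤ f s) (hp : ∀ s, f s = h s - (K *ᵥ h) s + c) : b ≤ c := by
  obtain ⟨s, hs⟩ := Finite.exists_min h
  have := le_mulVec_of_le h0 h1 hs s
  linarith [hb s, hp s]

lemma ge_of_poisson [Nonempty S] (h0 : ∀ s s', 0 ≤ K s s') (h1 : ∀ s, ∑ s', K s s' = 1)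
    {f h : S → ℝ} {b c : ℝ} (hb : ∀ s, f s ≤ b) (hp : ∀ s, f s = h s - (K *ᵥ h) s + c) : c ≤ b := by
  obtain ⟨s, hs⟩ := Finite.exists_max h
  have := mulVec_le_of_le h0 h1 hs s
  linarith [hb s, hp s]

/-- The operator `h ↦ h - K h + h(o)`, which inverts the Poisson equation. -/
def poissonMap (K : Matrix S S ℝ) (o : S) : (S → ℝ) →ₗ[ℝ] (S → ℝ) :=
  LinearMap.id - K.mulVecLin + (LinearMap.pi fun _ => LinearMap.proj o)

lemma poissonMap_apply (K : Matrix S S ℝ) (o : S) (h : S → ℝ) (s : S) :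
    poissonMap K o h s = h s - (K *ᵥ h) s + h o := by
  simp [poissonMap]

lemma IsStationaryDist.sum_mul_mulVec {μ : S → ℝ} (hμ : IsStationaryDist K μ) (h : S → ℝ) :
    ∑ s, μ s * (K *ᵥ h) s = ∑ s, μ s * h s := by
  calc ∑ s, μ s * (K *ᵥ h) s = ∑ s, ∑ s', μ s * K s s' * h s' := by
        simp only [Matrix.mulVec, dotProduct, Finset.mul_sum, mul_assoc]
    _ = ∑ s', (∑ s, μ s * K s s') * h s' := by rw [Finset.sum_comm]; simp only [Finset.sum_mul]
    _ = ∑ s, μ s * h s := by simp only [hμ.2.2]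

/-- Invariance of `μ` cancels `h - K h`, so only the constant survives. -/
lemma IsStationaryDist.sum_mul_eq_of_poisson {μ : S → ℝ} (hμ : IsStationaryDist K μ) {f h : S → ℝ}
    {c : ℝ} (hp : ∀ s, f s = h s - (K *ᵥ h) s + c) : ∑ s, μ s * f s = c := by
  simp only [hp, mul_add, mul_sub, Finset.sum_add_distrib, Finset.sum_sub_distrib,
    hμ.sum_mul_mulVec, ← Finset.sum_mul, hμ.2.1]
  ring

variable [DecidableEq S]

lemma pow_row_sum (h1 : ∀ s, ∑ s', K s s' = 1) (t : ℕ) (s : S) : ∑ s', (K ^ t) s s' = 1 := by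
  induction t generalizing s with
  | zero => simp [Matrix.one_apply]
  | succ t ih =>
    simp only [pow_succ, Matrix.mul_apply]
    rw [Finset.sum_comm]
    simp only [← Finset.mul_sum, h1, mul_one, ih]

lemma mulVec_pow_eq_self {h : S → ℝ} (hh : K *ᵥ h = h) (t : ℕ) : (K ^ t) *ᵥ h = h := by
  induction t with
  | zero => simp
  | succ t ih => rw [pow_succ, ← Matrix.mulVec_mulVec, hh, ih]

/-- Harmonic functions of a chain some power of which is positive are constant. -/
lemma eq_of_mulVec_eq_self [Nonempty S] (h1 : ∀ s, ∑ s', K s s' = 1) {t : ℕ}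
    (ht : ∀ s s', 0 < (K ^ t) s s') {h : S → ℝ} (hh : K *ᵥ h = h) (s s' : S) : h s = h s' := by
  obtain ⟨m, hm⟩ := Finite.exists_max h
  have key : ∑ s', (K ^ t) m s' * (h m - h s') = 0 := by
    have := congrFun (mulVec_pow_eq_self hh t) m
    change ∑ s', (K ^ t) m s' * h s' = h m at this
    simp only [mul_sub, Finset.sum_sub_distrib, ← Finset.sum_mul, pow_row_sum h1, one_mul, this,
      sub_self]
  have all : ∀ s', h s' = h m := fun s' => by
    have := (Finset.sum_eq_zero_iff_of_nonneg fun s' _ =>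
      mul_nonneg (ht m s').le (sub_nonneg.2 (hm s'))).1 key s' (Finset.mem_univ _)
    rcases mul_eq_zero.1 this with h' | h'
    · exact absurd h' (ht m s').ne'
    · linarith
  rw [all s, all s']

/-- For `h` in the kernel, comparison at a minimum and a maximum of `h` forces `h o = 0`; then `h`
is harmonic, hence constant, hence zero. -/
lemma poissonMap_injective [Nonempty S] (h0 : ∀ s s', 0 ≤ K s s') (h1 : ∀ s, ∑ s', K s s' = 1)
    {t : ℕ} (ht : ∀ s s', 0 < (K ^ t) s s') (o : S) : Function.Injective (poissonMap K o) := by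
  rw [← LinearMap.ker_eq_bot, LinearMap.ker_eq_bot']
  intro h hh
  have hp : ∀ s, (0 : S → ℝ) s = h s - (K *ᵥ h) s + h o := fun s => by
    rw [← poissonMap_apply, hh]
  have ho : h o = 0 := le_antisymm
    (ge_of_poisson h0 h1 (f := 0) (b := 0) (fun _ => le_rfl) hp)
    (le_of_poisson h0 h1 (f := 0) (b := 0) (fun _ => le_rfl) hp)
  have hK : K *ᵥ h = h := by
    funext s
    have := hp s
    simp only [Pi.zero_apply] at this
    linarith
  funext s
  rw [eq_of_mulVec_eq_self h1 ht hK s o, ho, Pi.zero_apply]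

lemma poissonMap_surjective [Nonempty S] (h0 : ∀ s s', 0 ≤ K s s') (h1 : ∀ s, ∑ s', K s s' = 1)
    {t : ℕ} (ht : ∀ s s', 0 < (K ^ t) s s') (o : S) : Function.Surjective (poissonMap K o) :=
  LinearMap.injective_iff_surjective.1 (poissonMap_injective h0 h1 ht o)

lemma exists_poisson [Nonempty S] (h0 : ∀ s s', 0 ≤ K s s') (h1 : ∀ s, ∑ s', K s s' = 1)
    {t : ℕ} (ht : ∀ s s', 0 < (K ^ t) s s') (f : S → ℝ) :
    ∃ (h : S → ℝ) (c : ℝ), ∀ s, f s = h s - (K *ᵥ h) s + c := by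
  obtain ⟨h, rfl⟩ := poissonMap_surjective h0 h1 ht (Classical.arbitrary S) f
  exact ⟨h, _, poissonMap_apply K _ h⟩

/-- The mass at `s` is the Poisson constant of the indicator of `s`, whichever stationary
distribution is used. -/
lemma IsStationaryDist.eq [Nonempty S] (h0 : ∀ s s', 0 ≤ K s s') (h1 : ∀ s, ∑ s', K s s' = 1)
    {t : ℕ} (ht : ∀ s s', 0 < (K ^ t) s s') {μ ν : S → ℝ} (hμ : IsStationaryDist K μ)
    (hν : IsStationaryDist K ν) : μ = ν := by
  funext s
  obtain ⟨h, c, hp⟩ := exists_poisson h0 h1 ht (Pi.single s 1)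
  have h2 := hμ.sum_mul_eq_of_poisson hp
  have h3 := hν.sum_mul_eq_of_poisson hp
  simp only [Pi.single_apply, mul_ite, mul_one, mul_zero, Finset.sum_ite_eq', Finset.mem_univ,
    if_true] at h2 h3
  rw [h2, h3]

/-- The functional `Λ` sending `f` to its Poisson constant is integration against the desired
measure; its weights are the values on indicators. -/
lemma exists_isStationaryDist [Nonempty S] (h0 : ∀ s s', 0 ≤ K s s') (h1 : ∀ s, ∑ s', K s s' = 1)
    {t : ℕ} (ht : ∀ s s', 0 < (K ^ t) s s') : ∃ μ, IsStationaryDist K μ := by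
  let o : S := Classical.arbitrary S
  let e := LinearEquiv.ofBijective (poissonMap K o)
    ⟨poissonMap_injective h0 h1 ht o, poissonMap_surjective h0 h1 ht o⟩
  let Λ : (S → ℝ) →ₗ[ℝ] ℝ := LinearMap.proj o ∘ₗ e.symm.toLinearMap
  have hΛ : ∀ h, Λ (poissonMap K o h) = h o := fun h => congrFun (e.symm_apply_apply h) o
  have hrep : ∀ f : S → ℝ, Λ f = ∑ s, f s * Λ (Pi.single s 1) := fun f => by
    conv_lhs => rw [pi_eq_sum_univ' f, map_sum]
    refine Finset.sum_congr rfl fun s _ => ?_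
    rw [map_smul, smul_eq_mul]
  refine ⟨fun s => Λ (Pi.single s 1), fun s => ?_, ?_, fun s' => ?_⟩
  · obtain ⟨h, hh⟩ := poissonMap_surjective h0 h1 ht o (Pi.single s 1)
    change 0 ≤ Λ (Pi.single s 1)
    rw [← hh, hΛ]
    refine le_of_poisson h0 h1 (f := Pi.single s 1) (h := h) (fun s' => ?_) fun s' => ?_
    · by_cases hs : s' = s <;> simp [hs]
    · rw [← poissonMap_apply, hh]
  · have h2 := hΛ fun _ => 1
    have h3 : poissonMap K o (fun _ => 1) = fun _ => 1 := by
      funext s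
      rw [poissonMap_apply, mulVec_const_of_row_sum h1]
      ring
    rw [h3, hrep] at h2
    simpa using h2
  -- Invariance is `Λ (f - K f) = 0`: this function is the image of `f - f o`, which vanishes at
  -- `o`.
  · set f : S → ℝ := Pi.single s' 1
    have h2 := hΛ (f - fun _ => f o)
    have h3 : poissonMap K o (f - fun _ => f o) = f - K *ᵥ f := by
      funext s
      rw [poissonMap_apply, Matrix.mulVec_sub, mulVec_const_of_row_sum h1]
      simp only [Pi.sub_apply]
      ring
    rw [h3, map_sub, hrep (K *ᵥ f)] at h2
    simp only [Pi.sub_apply, sub_self] at h2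
    have h4 : ∀ s, (K *ᵥ f) s = K s s' := fun s => by simp [f]
    simp only [h4] at h2
    simp only [mul_comm _ (K _ s')]
    linarith

/-- A uniform lower bound for the stationary distributions of the chains that dominate half of a
given chain, some power of which is positive. -/
lemma exists_pos_le_of_half_le {K : Matrix S S ℝ} (h0 : ∀ s s', 0 ≤ K s s') {t : ℕ}
    (ht : ∀ s s', 0 < (K ^ t) s s') (o : S) :
    ∃ δ : ℝ, 0 < δ ∧ ∀ (K' : Matrix S S ℝ) (μ : S → ℝ), (∀ s s', 2⁻¹ * K s s' ≤ K' s s') →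
      IsStationaryDist K' μ → δ ≤ μ o := by
  have : Nonempty S := ⟨o⟩
  obtain ⟨m, hm⟩ := Finite.exists_min fun s => (K ^ t) s o
  -- Domination passes to powers, `K' ^ t ≥ 2⁻ᵗ K ^ t`, and `μ o` is a `μ`-average of column `o` of
  -- `K' ^ t`.
  refine ⟨2⁻¹ ^ t * (K ^ t) m o, mul_pos (by positivity) (ht m o), fun K' μ hK' hμ => ?_⟩
  have hpow : ∀ n : ℕ, ∀ s s', 0 ≤ (K ^ n) s s' ∧ 2⁻¹ ^ n * (K ^ n) s s' ≤ (K' ^ n) s s' := by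
    intro n
    induction n with
    | zero =>
      intro s s'
      by_cases hs : s = s' <;> simp [hs]
    | succ n ih =>
      intro s s'
      simp only [pow_succ, Matrix.mul_apply, Finset.mul_sum]
      refine ⟨Finset.sum_nonneg fun j _ => mul_nonneg (ih s j).1 (h0 j s'),
        Finset.sum_le_sum fun j _ => ?_⟩
      calc (2⁻¹ : ℝ) ^ n * 2⁻¹ * ((K ^ n) s j * K j s')
          = (2⁻¹ ^ n * (K ^ n) s j) * (2⁻¹ * K j s') := by ring
        _ ≤ (K' ^ n) s j * K' j s' := mul_le_mul (ih s j).2 (hK' j s')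
            (mul_nonneg (by norm_num) (h0 j s'))
            ((mul_nonneg (by positivity) (ih s j).1).trans (ih s j).2)
  have hstat : ∀ n : ℕ, ∀ s', ∑ s, μ s * (K' ^ n) s s' = μ s' := by
    intro n
    induction n with
    | zero => intro s'; simp [Matrix.one_apply]
    | succ n ih =>
      intro s'
      simp only [pow_succ, Matrix.mul_apply, Finset.mul_sum]
      rw [Finset.sum_comm]
      simp only [← mul_assoc, ← Finset.sum_mul, ih, hμ.2.2]
  calc 2⁻¹ ^ t * (K ^ t) m o = ∑ s, μ s * (2⁻¹ ^ t * (K ^ t) m o) := by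
        rw [← Finset.sum_mul, hμ.2.1, one_mul]
    _ ≤ ∑ s, μ s * (K' ^ t) s o := Finset.sum_le_sum fun s _ =>
        mul_le_mul_of_nonneg_left
          ((mul_le_mul_of_nonneg_left (hm s) (by positivity)).trans (hpow t s o).2) (hμ.1 s)
    _ = μ o := hstat t o

end StochasticMatrix

/-! ### Poisson equation of a policy and performance difference. -/

namespace FiniteMDP

variable {S A : Type*} [Fintype S] [Fintype A]

/-- The expected one-step reward at `s` when `a` is played. -/
def expectedReward (M : FiniteMDP S A) (s : S) (a : A) : ℝ :=
  ∑ s', M.p s a s' * M.R s a s'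

/-- The expected one-step reward at `s` under the policy `π`. -/
def policyReward (M : FiniteMDP S A) (π : EuclideanSpace ℝ (S × A)) (s : S) : ℝ :=
  ∑ a, π (s, a) * M.expectedReward s a

/-- The state-action value for the relative value function `h`. -/
def actionValue (M : FiniteMDP S A) (h : S → ℝ) (s : S) (a : A) : ℝ :=
  M.expectedReward s a + ∑ s', M.p s a s' * h s'

lemma transitionMatrix_nonneg (M : FiniteMDP S A) {π : EuclideanSpace ℝ (S × A)}
    (hπ : π ∈ policySet S A) (s s' : S) : 0 ≤ M.transitionMatrix π s s' :=
  Finset.sum_nonneg fun a _ => mul_nonneg (hπ.1 s a) (M.p_nonneg s a s')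

lemma transitionMatrix_row_sum (M : FiniteMDP S A) {π : EuclideanSpace ℝ (S × A)}
    (hπ : π ∈ policySet S A) (s : S) : ∑ s', M.transitionMatrix π s s' = 1 := by
  simp only [transitionMatrix]
  rw [Finset.sum_comm]
  simp only [← Finset.mul_sum, M.p_sum, mul_one, hπ.2 s]

lemma sum_mul_actionValue (M : FiniteMDP S A) (π : EuclideanSpace ℝ (S × A)) (h : S → ℝ) (s : S) :
    ∑ a, π (s, a) * M.actionValue h s a =
      M.policyReward π s + (M.transitionMatrix π).mulVec h s := by
  have : (M.transitionMatrix π).mulVec h s = ∑ a, π (s, a) * ∑ s', M.p s a s' * h s' := by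
    change ∑ s', (∑ a, π (s, a) * M.p s a s') * h s' = _
    simp only [Finset.sum_mul, Finset.mul_sum, mul_assoc]
    rw [Finset.sum_comm]
  rw [this, policyReward, ← Finset.sum_add_distrib]
  exact Finset.sum_congr rfl fun a _ => mul_add _ _ _

/-- If `h` and `c` solve the Poisson equation of `π`, then the average reward of `π'` exceeds `c` by
the mean advantage of `π'` over `π` under the stationary distribution of `π'`. -/
lemma performance_difference (M : FiniteMDP S A) {π π' : EuclideanSpace ℝ (S × A)} {h h' μ : S → ℝ}
    {c c' : ℝ}
    (hp : ∀ s, M.policyReward π s = h s - (M.transitionMatrix π).mulVec h s + c)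
    (hp' : ∀ s, M.policyReward π' s = h' s - (M.transitionMatrix π').mulVec h' s + c')
    (hμ : IsStationaryDist (M.transitionMatrix π') μ) :
    c' - c = ∑ s, μ s * ∑ a, (π' (s, a) - π (s, a)) * M.actionValue h s a := by
  have h1 : ∀ s, ∑ a, (π' (s, a) - π (s, a)) * M.actionValue h s a =
      M.policyReward π' s + (M.transitionMatrix π').mulVec h s - h s - c := fun s => by
    simp only [sub_mul, Finset.sum_sub_distrib, sum_mul_actionValue, hp s]
    ring
  simp only [h1, mul_sub, mul_add, Finset.sum_sub_distrib, Finset.sum_add_distrib,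
    hμ.sum_mul_mulVec, ← Finset.sum_mul, hμ.2.1, hμ.sum_mul_eq_of_poisson hp']
  ring

/-! ### Finite histories and the limit defining the average reward. -/

variable [DecidableEq S]

/-- Conditioning on the first step of a history. -/
lemma sum_historyProb_succ (M : FiniteMDP S A) (π : EuclideanSpace ℝ (S × A)) (s : S) {T : ℕ}
    (G : (Fin (T + 2) → S) → (Fin (T + 1) → A) → ℝ) :
    ∑ x, ∑ a, M.historyProb π s x a * G x a =
      ∑ b, ∑ s', π (s, b) * M.p s b s' *
        ∑ x, ∑ a, M.historyProb π s' x a * G (Fin.cons s x) (Fin.cons b a) := by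
  -- The indicator in `historyProb π s'` leaves only the term `s' = x 0` of the sum.
  have hcons : ∀ (y : S) (b : A) (x : Fin (T + 1) → S) (a : Fin T → A),
      M.historyProb π s (Fin.cons y x : Fin (T + 2) → S) (Fin.cons b a) =
        if y = s then ∑ s', π (s, b) * M.p s b s' * M.historyProb π s' x a else 0 := by
    intro y b x a
    simp only [historyProb, Fin.prod_univ_succ, Fin.cons_zero, Fin.castSucc_zero, Fin.cons_succ,
      ← Fin.succ_castSucc]
    by_cases hy : y = s
    · subst hy
      simp only [if_true, one_mul, ite_mul, zero_mul, mul_ite, mul_zero, Finset.sum_ite_eq,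
        Finset.mem_univ]
    · simp only [hy, if_false, zero_mul]
  rw [← (Fin.consEquiv fun _ : Fin (T + 2) => S).sum_comp, Fintype.sum_prod_type]
  rw [Finset.sum_eq_single s]
  · simp_rw [← (Fin.consEquiv fun _ : Fin (T + 1) => A).sum_comp, Fintype.sum_prod_type]
    simp only [Fin.consEquiv, Equiv.coe_fn_mk, hcons, if_true]
    simp only [Finset.sum_mul, Finset.mul_sum, mul_assoc]
    rw [Finset.sum_comm]
    refine Finset.sum_congr rfl fun b _ => ?_
    symm
    rw [Finset.sum_comm]
    exact Finset.sum_congr rfl fun x _ => Finset.sum_comm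
  · intro y _ hy
    refine Finset.sum_eq_zero fun x _ => ?_
    rw [← (Fin.consEquiv fun _ : Fin (T + 1) => A).sum_comp]
    refine Finset.sum_eq_zero fun a _ => ?_
    simp only [Fin.consEquiv, Equiv.coe_fn_mk, hcons, hy, if_false, zero_mul]
  · simp

lemma sum_historyProb (M : FiniteMDP S A) {π : EuclideanSpace ℝ (S × A)} (hπ : π ∈ policySet S A)
    (T : ℕ) (s : S) :
    ∑ x : Fin (T + 1) → S, ∑ a : Fin T → A, M.historyProb π s x a = 1 := by
  induction T generalizing s with
  | zero =>
    rw [← (Equiv.funUnique (Fin 1) S).symm.sum_comp]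
    simp [historyProb]
  | succ T ih =>
    have h := M.sum_historyProb_succ π s (T := T) fun _ _ => 1
    simp only [mul_one, ih] at h
    rw [h]
    simp only [← Finset.mul_sum, M.p_sum, mul_one, hπ.2 s]

lemma expectedTotalReward_zero (M : FiniteMDP S A) (π : EuclideanSpace ℝ (S × A)) (s : S) :
    M.expectedTotalReward π s 0 = 0 := by
  simp [expectedTotalReward]

lemma expectedTotalReward_succ (M : FiniteMDP S A) {π : EuclideanSpace ℝ (S × A)}
    (hπ : π ∈ policySet S A) (s : S) (T : ℕ) :
    M.expectedTotalReward π s (T + 1) = M.policyReward π s +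
      (M.transitionMatrix π).mulVec (fun s' => M.expectedTotalReward π s' T) s := by
  have hstep : ∀ (b : A) (s' : S),
      ∑ x : Fin (T + 1) → S, ∑ a : Fin T → A, M.historyProb π s' x a *
        ∑ t : Fin (T + 1), M.R ((Fin.cons s x : Fin (T + 2) → S) t.castSucc)
          ((Fin.cons b a : Fin (T + 1) → A) t) ((Fin.cons s x : Fin (T + 2) → S) t.succ) =
      M.R s b s' + M.expectedTotalReward π s' T := by
    intro b s'
    have hR : ∀ (x : Fin (T + 1) → S) (a : Fin T → A),
        M.historyProb π s' x a * M.R s b (x 0) = M.historyProb π s' x a * M.R s b s' := by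
      intro x a
      by_cases hx : x 0 = s'
      · rw [hx]
      · simp [historyProb, hx]
    simp only [Fin.sum_univ_succ, Fin.castSucc_zero, Fin.cons_zero, Fin.cons_succ,
      ← Fin.succ_castSucc, mul_add, Finset.sum_add_distrib, hR]
    rw [expectedTotalReward]
    simp only [← Finset.sum_mul, M.sum_historyProb hπ T s', one_mul]
  rw [expectedTotalReward, M.sum_historyProb_succ π s fun x a =>
    ∑ t : Fin (T + 1), M.R (x t.castSucc) (a t) (x t.succ)]
  simp only [hstep, mul_add, Finset.sum_add_distrib]
  congr 1
  · simp only [policyReward, expectedReward, Finset.mul_sum, mul_assoc]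
  · simp only [Matrix.mulVec, dotProduct, transitionMatrix, Finset.sum_mul]
    exact Finset.sum_comm

/-- The error after `T + 1` steps is the transition matrix applied to the error after `T` steps; it
starts at `-h`, and averaging preserves bounds. -/
lemma abs_expectedTotalReward_sub_le (M : FiniteMDP S A) {π : EuclideanSpace ℝ (S × A)}
    (hπ : π ∈ policySet S A) {h : S → ℝ} {c B : ℝ} (hB : ∀ s, |h s| ≤ B)
    (hp : ∀ s, M.policyReward π s = h s - (M.transitionMatrix π).mulVec h s + c) (T : ℕ) (s : S) :
    |M.expectedTotalReward π s T - T * c - h s| ≤ B := by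
  induction T generalizing s with
  | zero => simpa [expectedTotalReward_zero] using hB s
  | succ T ih =>
    have h0 := M.transitionMatrix_nonneg hπ
    have h1 := M.transitionMatrix_row_sum hπ
    have key : M.expectedTotalReward π s (T + 1) - (T + 1 : ℕ) * c - h s =
        (M.transitionMatrix π).mulVec (fun s' => M.expectedTotalReward π s' T - T * c - h s') s := by
      have : (fun s' => M.expectedTotalReward π s' T - T * c - h s') =
          (fun s' => M.expectedTotalReward π s' T) - (fun _ => T * c) - h := rfl
      rw [this, Matrix.mulVec_sub, Matrix.mulVec_sub, mulVec_const_of_row_sum h1,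
        M.expectedTotalReward_succ hπ, hp]
      simp only [Pi.sub_apply]
      push_cast
      ring
    rw [key, abs_le]
    exact ⟨le_mulVec_of_le h0 h1 (fun s => (abs_le.1 (ih s)).1) s,
      mulVec_le_of_le h0 h1 (fun s => (abs_le.1 (ih s)).2) s⟩

lemma tendsto_expectedTotalReward (M : FiniteMDP S A) {π : EuclideanSpace ℝ (S × A)}
    (hπ : π ∈ policySet S A) {h : S → ℝ} {c : ℝ}
    (hp : ∀ s, M.policyReward π s = h s - (M.transitionMatrix π).mulVec h s + c) (s : S) :
    Tendsto (fun T : ℕ => (1 / (T : ℝ)) * M.expectedTotalReward π s T) atTop (𝓝 c) := by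
  have : Nonempty S := ⟨s⟩
  obtain ⟨m, hm⟩ := Finite.exists_max fun s => |h s|
  have hT : Tendsto (fun T : ℕ => (T : ℝ)⁻¹) atTop (𝓝 0) := tendsto_inv_atTop_nhds_zero_nat
  have h1 : Tendsto (fun T : ℕ => (T : ℝ)⁻¹ * (M.expectedTotalReward π s T - T * c - h s))
      atTop (𝓝 0) := by
    refine squeeze_zero_norm (fun T => ?_) (by simpa using hT.mul_const |h m|)
    rw [norm_mul, Real.norm_eq_abs, Real.norm_eq_abs, abs_of_nonneg (by positivity)]
    exact mul_le_mul_of_nonneg_left (M.abs_expectedTotalReward_sub_le hπ hm hp T s) (by positivity)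
  have h2 := (h1.add (hT.mul_const (h s))).add_const c
  simp only [zero_mul, zero_add] at h2
  refine h2.congr' ?_
  filter_upwards [eventually_gt_atTop 0] with T hT0
  have : (T : ℝ) ≠ 0 := by positivity
  field_simp
  ring

lemma avgReward_eq_of_poisson [Nonempty S] (M : FiniteMDP S A) {π : EuclideanSpace ℝ (S × A)}
    (hπ : π ∈ policySet S A) {h : S → ℝ} {c : ℝ}
    (hp : ∀ s, M.policyReward π s = h s - (M.transitionMatrix π).mulVec h s + c) :
    M.avgReward π = c :=
  (M.tendsto_expectedTotalReward hπ hp _).limUnder_eq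

/-- The Poisson equation of an ergodic policy, whose constant is the average reward. -/
lemma exists_poisson_avgReward [Nonempty S] (M : FiniteMDP S A) {π : EuclideanSpace ℝ (S × A)}
    (hπ : π ∈ policySet S A) (he : M.IsErgodic π) :
    ∃ h : S → ℝ, ∀ s, M.policyReward π s =
      h s - (M.transitionMatrix π).mulVec h s + M.avgReward π := by
  obtain ⟨t, -, ht⟩ := he
  obtain ⟨h, c, hp⟩ := exists_poisson (M.transitionMatrix_nonneg hπ)
    (M.transitionMatrix_row_sum hπ) ht (M.policyReward π)
  exact ⟨h, by rwa [M.avgReward_eq_of_poisson hπ hp]⟩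

lemma isStationaryDist_stationaryDist [Nonempty S] (M : FiniteMDP S A)
    {π : EuclideanSpace ℝ (S × A)} (hπ : π ∈ policySet S A) (he : M.IsErgodic π) :
    IsStationaryDist (M.transitionMatrix π) (M.stationaryDist π) := by
  obtain ⟨t, -, ht⟩ := he
  exact Classical.epsilon_spec (exists_isStationaryDist (M.transitionMatrix_nonneg hπ)
    (M.transitionMatrix_row_sum hπ) ht)

end FiniteMDP

/-! ### Projected gradient ascent on a compact convex set. -/

section ProjectedGradient

variable {E : Type*} [NormedAddCommGroup E] [InnerProductSpace ℝ E]

lemma IsProjectionOn.inner_le_zero {X : Set E} (hX : Convex ℝ X) {x y : E}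
    (h : IsProjectionOn X x y) {z : E} (hz : z ∈ X) : inner ℝ (x - y) (z - y) ≤ 0 := by
  have : Nonempty X := ⟨⟨y, h.1⟩⟩
  refine (norm_eq_iInf_iff_real_inner_le_zero hX h.1).1 (le_antisymm (le_ciInf fun w => ?_)
    (ciInf_le ⟨0, by rintro _ ⟨w, rfl⟩; exact norm_nonneg _⟩ (⟨y, h.1⟩ : X))) z hz
  rw [norm_sub_rev, norm_sub_rev x]
  exact (sq_le_sq₀ (norm_nonneg _) (norm_nonneg _)).1 (h.2 w.2)

variable [CompleteSpace E]

lemma HasGradientWithinAt.hasDerivWithinAt_segment {X : Set E} (hX : Convex ℝ X) {f : E → ℝ}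
    {g x y : E} (hx : x ∈ X) (hy : y ∈ X) {t : ℝ}
    (h : HasGradientWithinAt f g X (x + t • (y - x))) :
    HasDerivWithinAt (fun t : ℝ => f (x + t • (y - x))) (inner ℝ g (y - x)) (Set.Icc 0 1) t := by
  have hd : HasDerivWithinAt (fun t : ℝ => x + t • (y - x)) (y - x) (Set.Icc 0 1) t := by
    simpa using ((hasDerivAt_id t).smul_const (y - x)).const_add x |>.hasDerivWithinAt
  have hm : Set.MapsTo (fun t : ℝ => x + t • (y - x)) (Set.Icc 0 1) X := fun r hr =>
    hX.add_smul_sub_mem hx hy hr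
  have := HasFDerivWithinAt.comp_hasDerivWithinAt t h.hasFDerivWithinAt hd hm
  simpa [Function.comp_def] using this

/-- The descent lemma on a convex set, in its form for maximization. -/
lemma descent_lemma_on {X : Set E} (hX : Convex ℝ X) {f : E → ℝ} {g : E → E}
    (hf : ∀ x ∈ X, HasGradientWithinAt f (g x) X x) {L : ℝ}
    (hL : ∀ x ∈ X, ∀ y ∈ X, ‖g x - g y‖ ≤ L * ‖x - y‖) {x y : E} (hx : x ∈ X) (hy : y ∈ X) :
    f x + inner ℝ (g x) (y - x) - L / 2 * ‖y - x‖ ^ 2 ≤ f y := by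
  have hmem : ∀ t ∈ Set.Icc (0 : ℝ) 1, x + t • (y - x) ∈ X := fun t ht =>
    hX.add_smul_sub_mem hx hy ht
  -- The claim is `ψ 0 ≤ ψ 1`; the quadratic term is chosen so that the Lipschitz bound makes the
  -- derivative nonnegative.
  let ψ : ℝ → ℝ := fun t =>
    f (x + t • (y - x)) - t * inner ℝ (g x) (y - x) + t ^ 2 * (L / 2 * ‖y - x‖ ^ 2)
  have hd : ∀ t ∈ Set.Icc (0 : ℝ) 1, HasDerivWithinAt ψ
      (inner ℝ (g (x + t • (y - x))) (y - x) - inner ℝ (g x) (y - x) + t * (L * ‖y - x‖ ^ 2))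
      (Set.Icc 0 1) t := fun t ht => by
    have h1 := (hf _ (hmem t ht)).hasDerivWithinAt_segment hX hx hy
    have h2 := ((hasDerivAt_id t).mul_const (inner ℝ (g x) (y - x))).hasDerivWithinAt
      (s := Set.Icc 0 1)
    have h3 := (((hasDerivAt_id t).pow 2).mul_const (L / 2 * ‖y - x‖ ^ 2)).hasDerivWithinAt
      (s := Set.Icc 0 1)
    refine HasDerivWithinAt.congr_deriv (f := ψ) ((h1.sub h2).add h3) ?_
    norm_num
    ring
  have hmono : MonotoneOn ψ (Set.Icc 0 1) := by
    refine monotoneOn_of_hasDerivWithinAt_nonneg (convex_Icc 0 1)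
      (fun t ht => (hd t ht).continuousWithinAt)
      (fun t ht => (hd t (interior_subset ht)).mono interior_subset) fun t ht => ?_
    have ht' := interior_subset ht
    rw [← inner_sub_left]
    have h1 := (abs_le.1 (abs_real_inner_le_norm (g (x + t • (y - x)) - g x) (y - x))).1
    have h2 := hL _ (hmem t ht') x hx
    rw [add_sub_cancel_left, norm_smul, Real.norm_eq_abs, abs_of_nonneg ht'.1] at h2
    have h3 := mul_le_mul_of_nonneg_right h2 (norm_nonneg (y - x))
    nlinarith
  have := hmono (Set.left_mem_Icc.2 zero_le_one) (Set.right_mem_Icc.2 zero_le_one) zero_le_one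
  simp only [ψ, zero_smul, add_zero, one_smul, add_sub_cancel] at this
  linarith

/-- Cluster points of projected gradient ascent on a compact convex set are stationary. -/
lemma inner_le_zero_of_mapClusterPt {X : Set E} (hX : Convex ℝ X) (hXc : IsCompact X)
    {f : E → ℝ} {g : E → E} (hf : ∀ x ∈ X, HasGradientWithinAt f (g x) X x) {L : ℝ} (hL0 : 0 < L)
    (hL : ∀ x ∈ X, ∀ y ∈ X, ‖g x - g y‖ ≤ L * ‖x - y‖) {α : ℝ} (hα : 0 < α) (hαL : α ≤ 1 / L)
    {u : ℕ → E} (hu : ∀ k, u k ∈ X) (hstep : ∀ k, IsProjectionOn X (u k + α • g (u k)) (u (k + 1)))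
    {x : E} (hx : MapClusterPt x atTop u) {z : E} (hz : z ∈ X) : inner ℝ (z - x) (g x) ≤ 0 := by
  have hxX : x ∈ X := hXc.isClosed.mem_of_mapClusterPt hx (Eventually.of_forall hu)
  have hαL' : α * L ≤ 1 := by rwa [le_div_iff₀ hL0] at hαL
  have hproj : ∀ k, ∀ z ∈ X, α * inner ℝ (g (u k)) (z - u (k + 1)) ≤
      inner ℝ (u (k + 1) - u k) (z - u (k + 1)) := fun k z hz => by
    have h1 := (hstep k).inner_le_zero hX hz
    have h2 : u k + α • g (u k) - u (k + 1) = α • g (u k) - (u (k + 1) - u k) := by abel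
    rw [h2, inner_sub_left, real_inner_smul_left] at h1
    linarith
  -- Taking `z = u k` in `hproj` gives `‖d‖² ≤ α ⟪g, d⟫` for the step `d`. The descent lemma then
  -- loses at most `‖d‖² / 2`, since `α * L ≤ 1`; hence the factor `2`.
  have hinc : ∀ k, ‖u (k + 1) - u k‖ ^ 2 ≤ 2 * α * (f (u (k + 1)) - f (u k)) := fun k => by
    have h1 := hproj k (u k) (hu k)
    have h2 := descent_lemma_on hX hf hL (hu k) (hu (k + 1))
    rw [← neg_sub (u (k + 1)) (u k), inner_neg_right, inner_neg_right,
      real_inner_self_eq_norm_sq] at h1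
    have h3 := mul_le_mul_of_nonneg_left h2 hα.le
    have h4 := mul_le_mul_of_nonneg_right hαL' (sq_nonneg ‖u (k + 1) - u k‖)
    nlinarith
  have hfc : ContinuousOn f X := fun y hy => (hf y hy).hasFDerivWithinAt.continuousWithinAt
  obtain ⟨C, hC⟩ := (hXc.image_of_continuousOn hfc).bddAbove
  have hmono : Monotone fun k => f (u k) := monotone_nat_of_le_succ fun k => by
    have := (sq_nonneg _).trans (hinc k)
    have := nonneg_of_mul_nonneg_right this (by positivity)
    linarith
  have hlim := tendsto_atTop_ciSup hmono ⟨C, by rintro _ ⟨k, rfl⟩; exact hC ⟨u k, hu k, rfl⟩⟩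
  have hdiff : Tendsto (fun k => u (k + 1) - u k) atTop (𝓝 0) := by
    rw [tendsto_zero_iff_norm_tendsto_zero]
    have h1 : Tendsto (fun k => 2 * α * (f (u (k + 1)) - f (u k))) atTop (𝓝 0) := by
      simpa using (((tendsto_add_atTop_iff_nat 1).2 hlim).sub hlim).const_mul (2 * α)
    have h2 := squeeze_zero (fun k => sq_nonneg ‖u (k + 1) - u k‖) hinc h1
    simpa [Real.sqrt_sq (norm_nonneg _)] using h2.sqrt
  have hgc : ContinuousOn g X := by
    refine LipschitzOnWith.continuousOn (K := ⟨L, hL0.le⟩) ?_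
    exact LipschitzOnWith.of_dist_le_mul fun y hy w hw => by
      rw [dist_eq_norm, dist_eq_norm]; exact hL y hy w hw
  -- Steps vanish, so `u (φ k)` and `u (φ k + 1)` share the limit `x`, and `hproj` passes to the
  -- limit with right side `0`.
  obtain ⟨φ, hφ, hφx⟩ := hx.tendsto_subseq
  have hd := hdiff.comp hφ.tendsto_atTop
  have hs : Tendsto (fun k => u (φ k + 1)) atTop (𝓝 x) := by
    simpa [Function.comp_def] using hd.add hφx
  have hg : Tendsto (fun k => g (u (φ k))) atTop (𝓝 (g x)) :=
    (hgc x hxX).tendsto.comp (tendsto_nhdsWithin_iff.2 ⟨hφx, Eventually.of_forall fun k => hu _⟩)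
  have hzs := hs.const_sub z
  have := le_of_tendsto_of_tendsto' ((hg.inner hzs).const_mul α) (hd.inner hzs)
    fun k => hproj (φ k) z hz
  rw [inner_zero_left, real_inner_comm] at this
  exact nonpos_of_mul_nonpos_right this hα

end ProjectedGradient

/-! ### Geometry of the policy set. -/

section PolicySet

variable {S A : Type*} [Fintype A]

lemma convex_policySet : Convex ℝ (policySet S A) := by
  intro x hx y hy a b ha hb hab
  refine ⟨fun s c => ?_, fun s => ?_⟩
  · have := add_nonneg (mul_nonneg ha (hx.1 s c)) (mul_nonneg hb (hy.1 s c))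
    simpa using this
  · simp [Finset.sum_add_distrib, ← Finset.mul_sum, hx.2 s, hy.2 s, hab]

lemma isCompact_policySet [Fintype S] : IsCompact (policySet S A) := by
  have hcont : ∀ i : S × A, Continuous fun π : EuclideanSpace ℝ (S × A) => π i := fun i => by
    fun_prop
  refine Metric.isCompact_of_isClosed_isBounded ?_ ?_
  · have : policySet S A = (⋂ (s : S) (a : A), {π | 0 ≤ π (s, a)}) ∩
        ⋂ s : S, {π | ∑ a, π (s, a) = 1} := by
      ext π
      simp [policySet]
    rw [this]
    refine (isClosed_iInter fun s => isClosed_iInter fun a =>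
      isClosed_le continuous_const (hcont _)).inter (isClosed_iInter fun s =>
        isClosed_eq (continuous_finsetSum _ fun a _ => hcont _) continuous_const)
  · refine isBounded_iff_forall_norm_le.2 ⟨√(∑ _i : S × A, 1), fun π hπ => ?_⟩
    rw [EuclideanSpace.norm_eq]
    refine Real.sqrt_le_sqrt (Finset.sum_le_sum fun i _ => ?_)
    have h0 := hπ.1 i.1 i.2
    have h1 : π (i.1, i.2) ≤ 1 := hπ.2 i.1 ▸
      Finset.single_le_sum (f := fun a => π (i.1, a)) (fun a _ => hπ.1 i.1 a) (Finset.mem_univ _)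
    rw [Real.norm_eq_abs, abs_of_nonneg h0]
    exact pow_le_one₀ h0 h1

variable [DecidableEq S]

/-- The policy that follows `π'` at the state `o` and `π` elsewhere. -/
noncomputable def replaceAt (π π' : EuclideanSpace ℝ (S × A)) (o : S) : EuclideanSpace ℝ (S × A) :=
  WithLp.toLp 2 fun i => if i.1 = o then π' i else π i

lemma replaceAt_mem_policySet {π π' : EuclideanSpace ℝ (S × A)} (hπ : π ∈ policySet S A)
    (hπ' : π' ∈ policySet S A) (o : S) : replaceAt π π' o ∈ policySet S A := by
  refine ⟨fun s a => ?_, fun s => ?_⟩ <;> by_cases hs : s = o <;>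
    simp only [replaceAt, hs, if_true, if_false]
  exacts [hπ'.1 o a, hπ.1 s a, hπ'.2 o, hπ.2 s]

end PolicySet

/-! ### Stationary policies are optimal. -/

namespace FiniteMDP

variable {S A : Type*} [Fintype S] [DecidableEq S] [Nonempty S] [Fintype A]

/-- At a stationary policy, no policy has a positive advantage in any state. -/
lemma advantage_nonpos_of_mem_stationaryPolicies (M : FiniteMDP S A)
    (hM : ∀ π ∈ policySet S A, M.IsErgodic π)
    {g : EuclideanSpace ℝ (S × A) → EuclideanSpace ℝ (S × A)} (hg : M.IsGradientField g)
    {π π' : EuclideanSpace ℝ (S × A)} (hπ : π ∈ stationaryPolicies g) (hπ' : π' ∈ policySet S A)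
    {h : S → ℝ} (hp : ∀ s, M.policyReward π s =
      h s - (M.transitionMatrix π).mulVec h s + M.avgReward π) (o : S) :
    ∑ a, (π' (o, a) - π (o, a)) * M.actionValue h o a ≤ 0 := by
  by_contra! hD
  set D := ∑ a, (π' (o, a) - π (o, a)) * M.actionValue h o a
  have hq := replaceAt_mem_policySet hπ.1 hπ' o
  set q := replaceAt π π' o with hqdef
  obtain ⟨t, -, ht⟩ := hM π hπ.1
  obtain ⟨δ, hδ, hlow⟩ := exists_pos_le_of_half_le (M.transitionMatrix_nonneg hπ.1) ht o
  have hderiv : HasDerivWithinAt (fun r : ℝ => M.avgReward (π + r • (q - π)))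
      (inner ℝ (g π) (q - π)) (Set.Icc 0 1) 0 := by
    refine HasGradientWithinAt.hasDerivWithinAt_segment convex_policySet hπ.1 hq ?_
    simpa using hg π hπ.1
  -- The cap `r ≤ 1/2` keeps at least half of `π`, hence half of its transition matrix, so `δ` does
  -- not depend on `r`.
  have hgain : ∀ r ∈ Set.Ioc (0 : ℝ) 2⁻¹,
      δ * D ≤ slope (fun r : ℝ => M.avgReward (π + r • (q - π))) 0 r := fun r hr => by
    have hmem : π + r • (q - π) ∈ policySet S A :=
      convex_policySet.add_smul_sub_mem hπ.1 hq ⟨hr.1.le, hr.2.trans (by norm_num)⟩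
    obtain ⟨h', hp'⟩ := M.exists_poisson_avgReward hmem (hM _ hmem)
    have hμ := M.isStationaryDist_stationaryDist hmem (hM _ hmem)
    have hδμ : δ ≤ M.stationaryDist (π + r • (q - π)) o := by
      refine hlow _ _ (fun s s' => ?_) hμ
      rw [transitionMatrix, transitionMatrix, Finset.mul_sum]
      refine Finset.sum_le_sum fun a _ => ?_
      rw [← mul_assoc]
      refine mul_le_mul_of_nonneg_right ?_ (M.p_nonneg s a s')
      have h1 := hπ.1.1 s a
      have h2 := mul_nonneg hr.1.le (hq.1 s a)
      have h3 := mul_le_mul_of_nonneg_right hr.2 h1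
      simp only [PiLp.add_apply, PiLp.smul_apply, PiLp.sub_apply, smul_eq_mul]
      linarith
    have hdiff := M.performance_difference hp hp' hμ
    have hsum : ∀ s, ∑ a, ((π + r • (q - π)) (s, a) - π (s, a)) * M.actionValue h s a =
        if s = o then r * D else 0 := fun s => by
      by_cases hs : s = o
      · subst hs
        simp [D, hqdef, replaceAt, Finset.mul_sum, mul_assoc]
      · simp [hqdef, replaceAt, hs]
    simp only [hsum, mul_ite, mul_zero, Finset.sum_ite_eq', Finset.mem_univ, if_true] at hdiff
    simp only [slope_def_field, zero_smul, add_zero, sub_zero]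
    rw [hdiff, le_div_iff₀ hr.1]
    have := mul_le_mul_of_nonneg_right hδμ (mul_pos hr.1 hD).le
    linarith
  have hlim := hasDerivWithinAt_iff_tendsto_slope.1 hderiv
  have hne : Set.Ioc (0 : ℝ) 2⁻¹ ⊆ Set.Icc 0 1 \ {0} := fun r hr =>
    ⟨⟨hr.1.le, hr.2.trans (by norm_num)⟩, hr.1.ne'⟩
  have : (𝓝[Set.Ioc (0 : ℝ) 2⁻¹] 0).NeBot := by
    rw [nhdsWithin_Ioc_eq_nhdsGT (by norm_num)]
    infer_instance
  -- Letting `r` decrease to `0` gives `δ * D ≤ ⟪g π, q - π⟫`, contradicting stationarity tested at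
  -- `q`.
  have hge := ge_of_tendsto (hlim.mono_left (nhdsWithin_mono _ hne))
    (eventually_nhdsWithin_of_forall hgain)
  have := hπ.2 q hq
  rw [real_inner_comm] at this
  have := mul_pos hδ hD
  linarith

/-- Stationary policies are optimal. -/
lemma isOptimal_of_mem_stationaryPolicies (M : FiniteMDP S A)
    (hM : ∀ π ∈ policySet S A, M.IsErgodic π)
    {g : EuclideanSpace ℝ (S × A) → EuclideanSpace ℝ (S × A)} (hg : M.IsGradientField g)
    {π : EuclideanSpace ℝ (S × A)} (hπ : π ∈ stationaryPolicies g) : M.IsOptimal π := by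
  refine ⟨hπ.1, fun π' hπ' => ?_⟩
  obtain ⟨h, hp⟩ := M.exists_poisson_avgReward hπ.1 (hM π hπ.1)
  obtain ⟨h', hp'⟩ := M.exists_poisson_avgReward hπ' (hM π' hπ')
  have hμ := M.isStationaryDist_stationaryDist hπ' (hM π' hπ')
  have hdiff := M.performance_difference hp hp' hμ
  have := Finset.sum_nonpos fun s (_ : s ∈ Finset.univ) => mul_nonpos_of_nonneg_of_nonpos (hμ.1 s)
    (M.advantage_nonpos_of_mem_stationaryPolicies hM hg hπ hπ' hp s)
  change M.avgReward π' ≤ M.avgReward π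
  linarith

end FiniteMDP

/-! ### The main theorem. -/

theorem mainTheorem4 {S A : Type*} [Fintype S] [DecidableEq S] [Nonempty S] [Fintype A]
    [Nonempty A] (M : FiniteMDP S A) (hM : ∀ π ∈ policySet S A, M.IsErgodic π) :
    -- the average reward and the stationary distribution are well defined
    (∀ π ∈ policySet S A,
      (∀ s, Tendsto (fun T : ℕ => (1 / (T : ℝ)) * M.expectedTotalReward π s T) atTop
        (𝓝 (M.avgReward π))) ∧
      IsStationaryDist (M.transitionMatrix π) (M.stationaryDist π) ∧
      ∀ μ, IsStationaryDist (M.transitionMatrix π) μ → μ = M.stationaryDist π) ∧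
    ∀ g : EuclideanSpace ℝ (S × A) → EuclideanSpace ℝ (S × A), M.IsGradientField g →
      M.ratioConst g < ⊤ →
      -- gradient domination
      (∀ πs, M.IsOptimal πs → ∀ π ∈ stationaryPolicies g,
        ∃ m, IsGreatest ((fun π' => inner ℝ (π' - π) (g π)) '' policySet S A) m ∧
          M.avgReward πs - M.avgReward π ≤ (M.ratioConst g).toReal * m) ∧
      -- convergence of projected policy gradient
      ∀ L : ℝ, 0 < L →
        (∀ x ∈ policySet S A, ∀ y ∈ policySet S A, ‖g x - g y‖ ≤ L * ‖x - y‖) →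
        ∀ α : ℝ, 0 < α → α ≤ 1 / L →
        ∀ π : ℕ → EuclideanSpace ℝ (S × A), IsProjectedPolicyGradient g α π →
          (∃ x, MapClusterPt x atTop π) ∧ ∀ x, MapClusterPt x atTop π → M.IsOptimal x := by
  refine ⟨fun π hπ => ?_, fun g hg _ => ⟨fun πs hs π hπ => ?_, ?_⟩⟩
  · obtain ⟨h, hp⟩ := M.exists_poisson_avgReward hπ (hM π hπ)
    have hμ := M.isStationaryDist_stationaryDist hπ (hM π hπ)
    obtain ⟨t, -, ht⟩ := hM π hπ
    exact ⟨M.tendsto_expectedTotalReward hπ hp, hμ, fun μ h' =>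
      h'.eq (M.transitionMatrix_nonneg hπ) (M.transitionMatrix_row_sum hπ) ht hμ⟩
  -- At a stationary point the maximum is `0`, attained at `π' = π`.
  · refine ⟨0, ⟨⟨π, hπ.1, by simp⟩, ?_⟩, ?_⟩
    · rintro _ ⟨π', hπ', rfl⟩
      exact hπ.2 π' hπ'
    · rw [mul_zero, sub_nonpos]
      exact (M.isOptimal_of_mem_stationaryPolicies hM hg hπ).2 hs.1
  · intro L hL0 hL α hα hαL π hπ
    have hmem : ∀ k, π k ∈ policySet S A := fun k => by
      cases k with
      | zero => exact hπ.1
      | succ k => exact (hπ.2 k).1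
    refine ⟨?_, fun x hx => M.isOptimal_of_mem_stationaryPolicies hM hg ⟨?_, fun z hz => ?_⟩⟩
    · obtain ⟨x, -, hx⟩ := isCompact_policySet.exists_mapClusterPt (f := atTop) (u := π)
        (tendsto_principal.2 (Eventually.of_forall hmem))
      exact ⟨x, hx⟩
    · exact isCompact_policySet.isClosed.mem_of_mapClusterPt hx (Eventually.of_forall hmem)
    · exact inner_le_zero_of_mapClusterPt convex_policySet isCompact_policySet hg hL0 hL hα hαL
        hmem hπ.2 hx hz
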